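/- Let $d\ge 2$, $\mu=\frac d2-1$, and let $J_\nu$ denote the Bessel function of the first kind of order $\nu$. For $x\in\mathbb R^d\setminus\{0\}$ put $\mathrm{Pr}^\parallel_x=\frac{xx^T}{\|x\|^2}$ and $\mathrm{Pr}^\perp_x=\mathbb I_d-\frac{xx^T}{\|x\|^2}$. For a pair $(a,b)$ of real functions on $(0,\infty)$ let $M(a,b)=(M^\parallel(a,b),M^\perp(a,b))$ be the pair of functions on $(0,\infty)$ $$M^\parallel(a,b)(s)=\frac{2\pi}{s^\mu}\int_0^\infty t^{\mu+1}a(t)J_\mu(2\pi st)\,dt-\frac{2\mu+1}{s^{\mu+1}}\int_0^\infty t^\mu\,(a(t)-b(t))\,J_{\mu+1}(2\pi st)\,dt,\tag{20a}$$ $$M^\perp(a,b)(s)=\frac{2\pi}{s^\mu}\int_0^\infty t^{\mu+1}b(t)J_\mu(2\pi st)\,dt+\frac{1}{s^{\mu+1}}\int_0^\infty t^\mu\,(a(t)-b(t))\,J_{\mu+1}(2\pi st)\,dt.\tag{20b}$$ **Proposition 3.14.** Let $\mathbf k:\mathbb R^d\to\mathbb R^{d\times d}$ be integrable and of the form $\mathbf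 k(x)=k^\parallel(\|x\|)\mathrm{Pr}^\parallel_x+k^\perp(\|x\|)\mathrm{Pr}^\perp_x$ for all $x\ne0$, with $k^\parallel,k^\perp:(0,\infty)\to\mathbb R$, and suppose that its Fourier transform $\widehat{\mathbf k}(\xi)=\int_{\mathbb R^d}\mathbf k(x)e^{-2\pi i x\cdot\xi}\,dx$ is integrable. Then there are functions $h^\parallel,h^\perp:(0,\infty)\to\mathbb R$ with $$\widehat{\mathbf k}(\xi)=h^\parallel(\|\xi\|)\mathrm{Pr}^\parallel_\xi+h^\perp(\|\xi\|)\mathrm{Pr}^\perp_\xi\qquad(\xi\neq0),$$ and for any such functions: * $(h^\parallel,h^\perp)=M(k^\parallel,k^\perp)$ on $(0,\infty)$, and conversely $(k^\parallel,k^\perp)=M(h^\parallel,h^\perp)$ almost everywhere on $(0,\infty)$, all the integrals involved being absolutely convergent at every point of $(0,\infty)$; * the equality $k^\parallel(r)=M^\parallel(h^\parallel,h^\perp)(r)$ holds at every $r>0$ at which $k^\parallel$ is continuous, and $k^\perp(r)=M^\perp(h^\parallel,h^\perp)(r)$ holds at every $r>0$ at which $k^\perp$ is continuous. In particular $M(M(k^\parallel,k^\perp))=(k^\parallel,k^\perp)$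 almost everywhere on $(0,\infty)$, i.e. $M$ is an involution in this sense. -/

import Mathlib

open MeasureTheory Set
open scoped FourierTransform

noncomputable section

namespace TRI

/-- The Bessel function of the first kind of real order `ν`, by its ascending series
`J_ν(z) = ∑ₘ (-1)^m / (m! Γ(m + ν + 1)) (z/2)^(2m + ν)`, for real `z > 0`. -/
def besselJ (ν z : ℝ) : ℝ :=
  ∑' m : ℕ, (-1 : ℝ) ^ m / ((m.factorial : ℝ) * Real.Gamma ((m : ℝ) + ν + 1)) *
    (z / 2) ^ (2 * (m : ℝ) + ν)

/-- The order `μ = d/2 - 1`. -/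
def mu (d : ℕ) : ℝ := (d : ℝ) / 2 - 1

/-- The matrix `x xᵀ / ‖x‖²` of the orthogonal projection onto the line spanned by `x ≠ 0`. -/
def prPar {d : ℕ} (x : EuclideanSpace ℝ (Fin d)) : Matrix (Fin d) (Fin d) ℝ :=
  Matrix.of fun i j => x i * x j / ‖x‖ ^ 2

/-- The matrix `I - x xᵀ / ‖x‖²` of the orthogonal projection onto the hyperplane
perpendicular to `x ≠ 0`. -/
def prPerp {d : ℕ} (x : EuclideanSpace ℝ (Fin d)) : Matrix (Fin d) (Fin d) ℝ :=
  1 - prPar x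

/-- The matrix-valued function `F` (real- or complex-valued entries) can be written, for all
`x ≠ 0`, as `F x = a(‖x‖) Pr∥ + b(‖x‖) Pr⊥` with the real coefficients `a`, `b`. Only the values
of `a` and `b` at positive reals matter. -/
def HasCoefficients {𝕜 : Type*} [RCLike 𝕜] {d : ℕ}
    (F : EuclideanSpace ℝ (Fin d) → Matrix (Fin d) (Fin d) 𝕜) (a b : ℝ → ℝ) : Prop :=
  ∀ x : EuclideanSpace ℝ (Fin d), x ≠ 0 →
    F x = (a ‖x‖ • prPar x + b ‖x‖ • prPerp x).map (algebraMap ℝ 𝕜)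

/-- `F ∈ L¹(ℝᵈ, 𝕜^{d×d})`, i.e. every entry is integrable. -/
def MatIntegrable {𝕜 : Type*} [RCLike 𝕜] {d : ℕ}
    (F : EuclideanSpace ℝ (Fin d) → Matrix (Fin d) (Fin d) 𝕜) : Prop :=
  ∀ i j, Integrable (fun x => F x i j) volume

/-- The entrywise Fourier transform `ξ ↦ ∫ k(x) e^{-2πi x·ξ} dx`. -/
def matFourier {d : ℕ} (k : EuclideanSpace ℝ (Fin d) → Matrix (Fin d) (Fin d) ℝ)
    (ξ : EuclideanSpace ℝ (Fin d)) : Matrix (Fin d) (Fin d) ℂ :=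
  Matrix.of fun i j => 𝓕 (fun x => (k x i j : ℂ)) ξ

/-- The coefficient map `M`, sending a pair `(a, b)` of functions on `(0, ∞)` to the pair of
functions on `(0, ∞)` given by the two Hankel-type integral formulae. -/
def coeffMap (d : ℕ) (p : (ℝ → ℝ) × (ℝ → ℝ)) : (ℝ → ℝ) × (ℝ → ℝ) :=
  (fun s =>
      2 * Real.pi / s ^ mu d *
          (∫ t in Ioi (0 : ℝ), t ^ (mu d + 1) * p.1 t * besselJ (mu d) (2 * Real.pi * s * t)) -
        (2 * mu d + 1) / s ^ (mu d + 1) *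
          (∫ t in Ioi (0 : ℝ),
            t ^ mu d * (p.1 t - p.2 t) * besselJ (mu d + 1) (2 * Real.pi * s * t)),
    fun s =>
      2 * Real.pi / s ^ mu d *
          (∫ t in Ioi (0 : ℝ), t ^ (mu d + 1) * p.2 t * besselJ (mu d) (2 * Real.pi * s * t)) +
        1 / s ^ (mu d + 1) *
          (∫ t in Ioi (0 : ℝ),
            t ^ mu d * (p.1 t - p.2 t) * besselJ (mu d + 1) (2 * Real.pi * s * t)))

/-- The integrals that occur in `coeffMap d (a, b)` at the point `s` converge absolutely. -/
def CoeffMapConverges (d : ℕ) (p : (ℝ → ℝ) × (ℝ → ℝ)) (s : ℝ) : Prop :=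
  IntegrableOn (fun t => t ^ (mu d + 1) * p.1 t * besselJ (mu d) (2 * Real.pi * s * t))
      (Ioi (0 : ℝ)) volume ∧
    IntegrableOn (fun t => t ^ (mu d + 1) * p.2 t * besselJ (mu d) (2 * Real.pi * s * t))
      (Ioi (0 : ℝ)) volume ∧
    IntegrableOn (fun t => t ^ mu d * (p.1 t - p.2 t) * besselJ (mu d + 1) (2 * Real.pi * s * t))
      (Ioi (0 : ℝ)) volume

end TRI

end

noncomputable section

namespace TRI

/-! ### Gaussian moments on the line -/

/-! On the sphere of radius `r` the field is `b I + (a - b) ω ωᵀ`, so in polar coordinates its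
Fourier transform is governed by the transforms of `dω` and of `ω ωᵀ dω`. With `e` the unit
direction of the frequency and `ρ` its length times `r`, these are `Φ(ρ)` and `Ψ(ρ) I + (Φ(ρ) - d
Ψ(ρ)) e eᵀ`, where `Φ` is `sphereFourier` and `Ψ` is `sphereFourierPerp`. Collecting the components
along `e eᵀ` and `I - e eᵀ` gives `a Φ - (d - 1)(a - b) Ψ` and `b Φ + (a - b) Ψ`; since `d - 1 = 2μ
+ 1`, integrating in `r` yields the map `M` (`hasCoefficients_matFourier`).

The Bessel form of `Φ` and `Ψ` comes from integrating the exponential series termwise over the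
sphere. The moments needed are found by evaluating a Gaussian integral of a monomial both in
Cartesian and in polar coordinates (`integral_sphere_prod_repr_pow`).

For the converse, the transform is again an integrable radial field with real coefficients, and such
a field is even, so inverse and forward transforms agree on it. Fourier inversion
(`fourierInv_fourier_ae_eq`) then gives `M(M(k)) = k` almost everywhere (`ae_eq_coeffMap`). The
right-hand side is continuous, being read off from a Fourier transform of an integrable field, which
upgrades the identity to every continuity point. -/

/-- The `n`-th moment of the weight `exp (-x²)` on the real line. -/
def gaussMoment (n : ℕ) : ℝ := ∫ x : ℝ, x ^ n * Real.exp (-x ^ 2)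

lemma integrable_pow_mul_exp_neg_sq (n : ℕ) :
    Integrable fun x : ℝ => x ^ n * Real.exp (-x ^ 2) := by
  have h := integrable_rpow_mul_exp_neg_mul_sq (b := 1) one_pos (s := n)
    (by have : (0 : ℝ) ≤ n := n.cast_nonneg
        linarith)
  simpa using h

lemma gaussMoment_odd {n : ℕ} (hn : Odd n) : gaussMoment n = 0 := by
  have h := integral_neg_eq_self (fun x : ℝ => x ^ n * Real.exp (-x ^ 2)) volume
  simp only [hn.neg_pow, even_two.neg_pow, neg_mul, integral_neg] at h
  unfold gaussMoment
  linarith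

lemma integral_Ioi_pow_mul_exp_neg_sq (n : ℕ) :
    ∫ x in Ioi (0 : ℝ), x ^ n * Real.exp (-x ^ 2) = Real.Gamma (((n : ℝ) + 1) / 2) / 2 := by
  have h := integral_rpow_mul_exp_neg_rpow (p := 2) (q := n) two_pos
    (by have : (0 : ℝ) ≤ n := n.cast_nonneg
        linarith)
  simp only [Real.rpow_natCast, Real.rpow_ofNat] at h
  rw [h]; ring

lemma gaussMoment_even (m : ℕ) : gaussMoment (2 * m) = Real.Gamma ((m : ℝ) + 1 / 2) := by
  have h := integral_comp_abs (f := fun x : ℝ => x ^ (2 * m) * Real.exp (-x ^ 2))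
  simp only [sq_abs, (even_two_mul m).pow_abs] at h
  rw [gaussMoment, h, integral_Ioi_pow_mul_exp_neg_sq]
  push_cast
  rw [show (2 * (m : ℝ) + 1) / 2 = m + 1 / 2 by ring]
  ring

lemma gaussMoment_zero : gaussMoment 0 = √Real.pi := by
  have h := gaussMoment_even 0
  simpa only [mul_zero, Nat.cast_zero, zero_add, Real.Gamma_one_half_eq] using h

lemma gaussMoment_add_two (n : ℕ) : gaussMoment (n + 2) = ((n : ℝ) + 1) / 2 * gaussMoment n := by
  rcases n.even_or_odd with h | h
  · obtain ⟨m, rfl⟩ := h.exists_two_nsmul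
    rw [smul_eq_mul, show 2 * m + 2 = 2 * (m + 1) by ring, gaussMoment_even, gaussMoment_even,
      Nat.cast_add, Nat.cast_one, add_right_comm, Real.Gamma_add_one (by positivity)]
    push_cast; ring
  · rw [gaussMoment_odd h, gaussMoment_odd (h.add_even even_two), mul_zero]

/-- In this form the factor `(2m)!` cancels against the exponential series and leaves the `1 / m!`
of the Bessel series. -/
lemma gaussMoment_two_mul (m : ℕ) :
    gaussMoment (2 * m) = ((2 * m).factorial : ℝ) / (4 ^ m * m.factorial) * √Real.pi := by
  induction m with
  | zero => simp [gaussMoment_zero]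
  | succ m ih =>
    rw [show 2 * (m + 1) = 2 * m + 2 by ring, gaussMoment_add_two, ih, Nat.factorial_succ,
      Nat.factorial_succ, Nat.factorial_succ m]
    have := Nat.factorial_pos m
    push_cast
    field_simp
    ring

/-! ### Gaussian moments in Euclidean space -/

variable {d : ℕ}

lemma norm_sq_eq_sum_repr (b : OrthonormalBasis (Fin d) ℝ (EuclideanSpace ℝ (Fin d)))
    (x : EuclideanSpace ℝ (Fin d)) : ‖x‖ ^ 2 = ∑ i, b.repr x i ^ 2 := by
  rw [← b.repr.norm_map, EuclideanSpace.norm_sq_eq]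
  simp

/-- By Parseval the weight `exp (-‖x‖²)` factorises over the coordinates of any orthonormal basis,
so Gaussian moments reduce to one-dimensional ones. -/
lemma prod_repr_pow_mul_exp (b : OrthonormalBasis (Fin d) ℝ (EuclideanSpace ℝ (Fin d)))
    (p : Fin d → ℕ) (x : EuclideanSpace ℝ (Fin d)) :
    (∏ i, b.repr x i ^ p i) * Real.exp (-‖x‖ ^ 2) =
      (fun y : Fin d → ℝ => ∏ i, (y i ^ p i * Real.exp (-y i ^ 2)))
        (WithLp.ofLp (b.repr x)) := by
  simp only [norm_sq_eq_sum_repr b, Finset.prod_mul_distrib, ← Finset.sum_neg_distrib,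
    Real.exp_sum]

lemma measurePreserving_ofLp_repr
    (b : OrthonormalBasis (Fin d) ℝ (EuclideanSpace ℝ (Fin d))) :
    MeasurePreserving (fun x => WithLp.ofLp (b.repr x)) :=
  (PiLp.volume_preserving_ofLp (Fin d)).comp b.measurePreserving_repr

lemma measurableEmbedding_ofLp_repr
    (b : OrthonormalBasis (Fin d) ℝ (EuclideanSpace ℝ (Fin d))) :
    MeasurableEmbedding (fun x => WithLp.ofLp (b.repr x)) :=
  (MeasurableEquiv.toLp 2 (Fin d → ℝ)).symm.measurableEmbedding.comp
    b.repr.toHomeomorph.measurableEmbedding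

lemma integrable_prod_repr_pow_mul_exp
    (b : OrthonormalBasis (Fin d) ℝ (EuclideanSpace ℝ (Fin d))) (p : Fin d → ℕ) :
    Integrable fun x => (∏ i, b.repr x i ^ p i) * Real.exp (-‖x‖ ^ 2) := by
  simp only [prod_repr_pow_mul_exp]
  refine ((measurePreserving_ofLp_repr b).integrable_comp_emb (measurableEmbedding_ofLp_repr b)
    (g := fun y : Fin d → ℝ => ∏ i, (y i ^ p i * Real.exp (-y i ^ 2)))).2 ?_
  exact Integrable.fintype_prod (μ := fun _ : Fin d => (volume : Measure ℝ))
    (f := fun i (y : ℝ) => y ^ p i * Real.exp (-y ^ 2))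
    fun i => integrable_pow_mul_exp_neg_sq (p i)

lemma integral_prod_repr_pow_mul_exp
    (b : OrthonormalBasis (Fin d) ℝ (EuclideanSpace ℝ (Fin d))) (p : Fin d → ℕ) :
    ∫ x, (∏ i, b.repr x i ^ p i) * Real.exp (-‖x‖ ^ 2) = ∏ i, gaussMoment (p i) := by
  simp only [prod_repr_pow_mul_exp]
  refine ((measurePreserving_ofLp_repr b).integral_comp (measurableEmbedding_ofLp_repr b)
    (fun y : Fin d → ℝ => ∏ i, (y i ^ p i * Real.exp (-y i ^ 2)))).trans ?_
  exact integral_fintype_prod_volume_eq_prod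
    fun i (y : ℝ) => y ^ p i * Real.exp (-y ^ 2)

/-! ### Polar coordinates -/

/-- The surface measure on the unit sphere of `ℝᵈ`. -/
abbrev sphereMeasure (d : ℕ) : Measure (Metric.sphere (0 : EuclideanSpace ℝ (Fin d)) 1) :=
  (volume : Measure (EuclideanSpace ℝ (Fin d))).toSphere

lemma integral_volumeIoiPow {G : Type*} [NormedAddCommGroup G] [NormedSpace ℝ G] (n : ℕ)
    (f : ℝ → G) :
    ∫ r : Ioi (0 : ℝ), f r ∂Measure.volumeIoiPow n = ∫ r in Ioi (0 : ℝ), r ^ n • f r := by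
  simp only [Measure.volumeIoiPow, ENNReal.ofReal]
  rw [integral_withDensity_eq_integral_smul,
    integral_subtype_comap measurableSet_Ioi fun a ↦ Real.toNNReal (a ^ n) • f a,
    setIntegral_congr_fun measurableSet_Ioi fun x hx ↦ ?_]
  · rw [NNReal.smul_def, Real.coe_toNNReal _ (pow_nonneg hx.out.le _)]
  · exact (measurable_subtype_coe.pow_const _).real_toNNReal

/-- The polar homeomorphism is defined off the origin, which is a null set because `d ≥ 1`; the rest
is Fubini. -/
lemma integral_eq_integral_Ioi_sphere {G : Type*} [NormedAddCommGroup G] [NormedSpace ℝ G]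
    [NeZero d] (F : EuclideanSpace ℝ (Fin d) → G) (hF : Integrable F) :
    ∫ x, F x = ∫ r in Ioi (0 : ℝ), r ^ (d - 1) • ∫ ω, F (r • (ω : EuclideanSpace ℝ (Fin d)))
      ∂sphereMeasure d := by
  have hmp := (volume : Measure (EuclideanSpace ℝ (Fin d))).measurePreserving_homeomorphUnitSphereProd
  have hme := (homeomorphUnitSphereProd (EuclideanSpace ℝ (Fin d))).measurableEmbedding
  rw [finrank_euclideanSpace_fin] at hmp
  let g : Metric.sphere (0 : EuclideanSpace ℝ (Fin d)) 1 × Ioi (0 : ℝ) → G :=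
    fun z => F (z.2.1 • z.1.1)
  have hg : ∀ x, g (homeomorphUnitSphereProd (EuclideanSpace ℝ (Fin d)) x) = F x := by
    intro x
    have := (homeomorphUnitSphereProd (EuclideanSpace ℝ (Fin d))).symm_apply_apply x
    conv_rhs => rw [← this]
    rw [homeomorphUnitSphereProd_symm_apply_coe]
  have hgi : Integrable g ((sphereMeasure d).prod (Measure.volumeIoiPow (d - 1))) := by
    rw [← hmp.integrable_comp_emb hme]
    have : Integrable (fun x : ({0}ᶜ : Set (EuclideanSpace ℝ (Fin d))) => F x)
        (Measure.comap Subtype.val volume) := by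
      have := (integrableOn_iff_comap_subtypeVal (s := ({0}ᶜ : Set (EuclideanSpace ℝ (Fin d))))
        (by measurability)).1 hF.integrableOn
      exact this
    refine this.congr (Filter.Eventually.of_forall fun x => ?_)
    simp [hg]
  calc ∫ x, F x = ∫ x : ({0}ᶜ : Set (EuclideanSpace ℝ (Fin d))), F x
        ∂(Measure.comap Subtype.val volume) := by
        rw [integral_subtype_comap (measurableSet_singleton _).compl F, restrict_compl_singleton]
    _ = ∫ z, g z ∂((sphereMeasure d).prod (Measure.volumeIoiPow (d - 1))) := by
        rw [← hmp.integral_comp hme]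
        simp only [hg]
    _ = ∫ r : Ioi (0 : ℝ), (fun r : ℝ => ∫ ω, F (r • (ω : EuclideanSpace ℝ (Fin d)))
          ∂sphereMeasure d) r ∂Measure.volumeIoiPow (d - 1) := integral_prod_symm _ hgi
    _ = _ := integral_volumeIoiPow (d - 1) fun r : ℝ =>
          ∫ ω, F (r • (ω : EuclideanSpace ℝ (Fin d))) ∂sphereMeasure d

/-- Homogeneity separates the polar integral into the sphere integral of `g` and the radial integral
of `r ^ (n + d - 1) exp (-r²)`, which is half a Gamma value. -/
lemma integral_homogeneous_mul_exp [NeZero d] (n : ℕ) (g : EuclideanSpace ℝ (Fin d) → ℝ)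
    (hg : ∀ (r : ℝ) (x : EuclideanSpace ℝ (Fin d)), g (r • x) = r ^ n * g x)
    (hint : Integrable fun x => g x * Real.exp (-‖x‖ ^ 2)) :
    ∫ x, g x * Real.exp (-‖x‖ ^ 2) =
      (∫ ω, g (ω : EuclideanSpace ℝ (Fin d)) ∂sphereMeasure d) *
        (Real.Gamma (((n : ℝ) + d) / 2) / 2) := by
  have hd : 0 < d := Nat.pos_of_ne_zero (NeZero.ne d)
  rw [integral_eq_integral_Ioi_sphere _ hint]
  have key : ∀ r ∈ Ioi (0 : ℝ), r ^ (d - 1) • ∫ ω, g (r • (ω : EuclideanSpace ℝ (Fin d))) *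
      Real.exp (-‖r • (ω : EuclideanSpace ℝ (Fin d))‖ ^ 2) ∂sphereMeasure d =
      (∫ ω, g (ω : EuclideanSpace ℝ (Fin d)) ∂sphereMeasure d) *
        (r ^ (n + (d - 1)) * Real.exp (-r ^ 2)) := by
    intro r _
    simp only [hg, norm_smul, norm_eq_of_mem_sphere, mul_one, Real.norm_eq_abs, sq_abs]
    rw [integral_mul_const, integral_const_mul, smul_eq_mul, pow_add]
    ring
  rw [setIntegral_congr_fun measurableSet_Ioi key, integral_const_mul,
    integral_Ioi_pow_mul_exp_neg_sq]
  congr 4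
  push_cast [Nat.cast_sub hd]
  ring

lemma integral_sphere_prod_repr_pow [NeZero d]
    (b : OrthonormalBasis (Fin d) ℝ (EuclideanSpace ℝ (Fin d))) (p : Fin d → ℕ) :
    ∫ ω, ∏ i, b.repr (ω : EuclideanSpace ℝ (Fin d)) i ^ p i ∂sphereMeasure d =
      2 * (∏ i, gaussMoment (p i)) / Real.Gamma (((∑ i, p i : ℕ) + d) / 2) := by
  have h := integral_homogeneous_mul_exp (d := d) (∑ i, p i) (fun x => ∏ i, b.repr x i ^ p i)
    (fun r x => by
      simp [mul_pow, Finset.prod_mul_distrib, Finset.prod_pow_eq_pow_sum])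
    (integrable_prod_repr_pow_mul_exp b p)
  rw [integral_prod_repr_pow_mul_exp] at h
  have hd : (0 : ℝ) < d := by exact_mod_cast Nat.pos_of_ne_zero (NeZero.ne d)
  have := (Real.Gamma_pos_of_pos (s := ((∑ i, p i : ℕ) + (d : ℝ)) / 2) (by positivity)).ne'
  rw [h]
  field_simp

/-! ### Moments of the sphere -/

/-- The moments `∫ ω₀ⁿ dω` over the unit sphere of `ℝᵈ`. -/
def sphereMoment (d n : ℕ) : ℝ :=
  2 * (√Real.pi ^ d * (gaussMoment n / √Real.pi)) / Real.Gamma (((n : ℝ) + d) / 2)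

/-- The moments `∫ ω₀ⁿ ω₁² dω` over the unit sphere of `ℝᵈ`. -/
def sphereMomentPerp (d n : ℕ) : ℝ :=
  √Real.pi ^ d * (gaussMoment n / √Real.pi) / Real.Gamma (((n : ℝ) + d) / 2 + 1)

/-- This is `Γ(x + 1) = x Γ(x)` at `x = (n + d) / 2`. It later trades the factor `n` in the
quadratic moments for a combination of two known series. -/
lemma add_mul_sphereMomentPerp [NeZero d] (n : ℕ) :
    ((n : ℝ) + d) * sphereMomentPerp d n = sphereMoment d n := by
  have hd : (0 : ℝ) < d := by exact_mod_cast Nat.pos_of_ne_zero (NeZero.ne d)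
  have hpos : 0 < ((n : ℝ) + d) / 2 := by positivity
  have := (Real.Gamma_pos_of_pos hpos).ne'
  rw [sphereMomentPerp, sphereMoment, Real.Gamma_add_one hpos.ne']
  field_simp

lemma sphereMoment_odd {n : ℕ} (hn : Odd n) : sphereMoment d n = 0 := by
  simp [sphereMoment, gaussMoment_odd hn]

lemma sphereMomentPerp_odd {n : ℕ} (hn : Odd n) : sphereMomentPerp d n = 0 := by
  simp [sphereMomentPerp, gaussMoment_odd hn]

/-- After division by `√π` every coordinate with exponent `0` contributes `1`, so only the few
coordinates that occur in the monomial remain. -/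
lemma prod_gaussMoment (p : Fin d → ℕ) :
    ∏ i, gaussMoment (p i) = √Real.pi ^ d * ∏ i, (gaussMoment (p i) / √Real.pi) := by
  have : √Real.pi ≠ 0 := (Real.sqrt_pos.2 Real.pi_pos).ne'
  rw [Finset.prod_div_distrib]
  simp
  field_simp

lemma gaussMoment_zero_div : gaussMoment 0 / √Real.pi = 1 := by
  rw [gaussMoment_zero, div_self (Real.sqrt_pos.2 Real.pi_pos).ne']

lemma prod_pow_single {ι : Type*} [Fintype ι] [DecidableEq ι] (x : ι → ℝ) (i : ι) (n : ℕ) :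
    ∏ k, x k ^ (Pi.single i n : ι → ℕ) k = x i ^ n := by
  rw [Finset.prod_eq_single i (fun k _ hk => by simp [hk]) (by simp), Pi.single_eq_same]

lemma integral_sphere_repr_pow [NeZero d]
    (b : OrthonormalBasis (Fin d) ℝ (EuclideanSpace ℝ (Fin d))) (i₀ : Fin d) (n : ℕ) :
    ∫ ω, b.repr (ω : EuclideanSpace ℝ (Fin d)) i₀ ^ n ∂sphereMeasure d = sphereMoment d n := by
  have h := integral_sphere_prod_repr_pow b (Pi.single i₀ n)
  simp only [prod_pow_single, prod_gaussMoment, Finset.sum_pi_single', Finset.mem_univ,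
    if_true] at h
  rw [h, Finset.prod_eq_single i₀ (fun k _ hk => by simp [hk, gaussMoment_zero_div]) (by simp),
    Pi.single_eq_same, sphereMoment]

lemma prod_gaussMoment_quadratic (i₀ i j : Fin d) (n : ℕ) :
    ∏ k, (gaussMoment ((Pi.single i₀ n + Pi.single i 1 + Pi.single j 1 : Fin d → ℕ) k) / √Real.pi)
      = gaussMoment n / √Real.pi / 2 *
        ((if i = j then 1 else 0) + n * ((if i = i₀ then 1 else 0) * (if j = i₀ then 1 else 0))) := by
  have hπ : √Real.pi ≠ 0 := (Real.sqrt_pos.2 Real.pi_pos).ne'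
  by_cases hij : i = j
  · subst hij
    by_cases hi : i = i₀
    · subst hi
      rw [Finset.prod_eq_single i (fun k _ hk => by simp [hk, gaussMoment_zero_div]) (by simp)]
      simp only [Pi.add_apply, Pi.single_eq_same, add_assoc, one_add_one_eq_two,
        gaussMoment_add_two, if_true]
      ring
    · rw [Finset.prod_eq_mul i₀ i (Ne.symm hi)
        (fun k _ hk => by simp [hk.1, hk.2, gaussMoment_zero_div]) (by simp) (by simp)]
      have h2 := gaussMoment_add_two 0
      simp only [Pi.add_apply, Pi.single_eq_same, Pi.single_eq_of_ne hi,
        Pi.single_eq_of_ne (Ne.symm hi), zero_add, add_zero, one_add_one_eq_two, if_true, hi,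
        if_false] at h2 ⊢
      rw [h2, gaussMoment_zero]
      field_simp
      simp
  · have hz : ¬ (i = i₀ ∧ j = i₀) := fun h => hij (h.1.trans h.2.symm)
    have hr : ((if i = i₀ then 1 else 0) * (if j = i₀ then 1 else 0) : ℝ) = 0 := by
      by_cases hi : i = i₀
      · have : j ≠ i₀ := fun h => hz ⟨hi, h⟩
        simp [this]
      · simp [hi]
    rw [hr, if_neg hij]
    simp only [mul_zero, add_zero]
    -- For `i ≠ j`, at least one of them differs from `i₀`; that coordinate has exponent exactly
    -- `1`, and its odd moment kills the product.
    by_cases hi : i = i₀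
    · have hj : j ≠ i₀ := fun h => hz ⟨hi, h⟩
      refine Finset.prod_eq_zero (Finset.mem_univ j) ?_
      simp [hj, Ne.symm hij, gaussMoment_odd]
    · refine Finset.prod_eq_zero (Finset.mem_univ i) ?_
      simp [hi, hij, gaussMoment_odd]

lemma integral_sphere_repr_quadratic [NeZero d]
    (b : OrthonormalBasis (Fin d) ℝ (EuclideanSpace ℝ (Fin d))) (i₀ i j : Fin d) (n : ℕ) :
    ∫ ω, b.repr (ω : EuclideanSpace ℝ (Fin d)) i * b.repr (ω : EuclideanSpace ℝ (Fin d)) j *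
        b.repr (ω : EuclideanSpace ℝ (Fin d)) i₀ ^ n ∂sphereMeasure d =
      sphereMomentPerp d n * ((if i = j then 1 else 0) +
        n * ((if i = i₀ then 1 else 0) * (if j = i₀ then 1 else 0))) := by
  have h := integral_sphere_prod_repr_pow b (Pi.single i₀ n + Pi.single i 1 + Pi.single j 1)
  rw [prod_gaussMoment, prod_gaussMoment_quadratic] at h
  simp only [Pi.add_apply, pow_add, Finset.prod_mul_distrib, prod_pow_single, pow_one,
    Finset.sum_add_distrib, Finset.sum_pi_single', Finset.mem_univ, if_true] at h
  rw [sphereMomentPerp]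
  calc _ = ∫ ω, b.repr (ω : EuclideanSpace ℝ (Fin d)) i₀ ^ n *
        b.repr (ω : EuclideanSpace ℝ (Fin d)) i * b.repr (ω : EuclideanSpace ℝ (Fin d)) j
        ∂sphereMeasure d := by
        congr 1; ext ω; ring
    _ = _ := by
        rw [h]
        push_cast
        rw [show ((n : ℝ) + 1 + 1 + d) / 2 = ((n : ℝ) + d) / 2 + 1 by ring]
        ring

/-! ### Fourier transforms on the sphere -/

/-- Since `|g|` and `|c|` are at most `1`, the summable constants `‖z‖ ^ n / n!` dominate the terms,
and they are integrable over a finite measure. -/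
lemma hasSum_integral_mul_cexp {X : Type*} [MeasurableSpace X] [TopologicalSpace X]
    [OpensMeasurableSpace X] [SecondCountableTopology X] (σ : Measure X)
    [IsFiniteMeasure σ] (g : X → ℂ) (hg : Continuous g) (c : X → ℝ) (hc : Continuous c)
    (hg1 : ∀ x, ‖g x‖ ≤ 1) (hc1 : ∀ x, |c x| ≤ 1) (z : ℂ) :
    HasSum (fun n : ℕ => z ^ n / n.factorial * ∫ x, g x * (c x : ℂ) ^ n ∂σ)
      (∫ x, g x * Complex.exp (z * c x) ∂σ) := by
  have h := hasSum_integral_of_dominated_convergence (μ := σ)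
    (F := fun n x => z ^ n / n.factorial * (g x * (c x : ℂ) ^ n))
    (f := fun x => g x * Complex.exp (z * c x))
    (fun n _ => ‖z‖ ^ n / n.factorial) ?_ ?_ ?_ ?_ ?_
  · simpa only [integral_const_mul] using h
  · intro n
    exact Continuous.aestronglyMeasurable (by fun_prop)
  · refine fun n => Filter.Eventually.of_forall fun x => ?_
    simp only [norm_mul, norm_div, norm_pow, Complex.norm_natCast, Complex.norm_real,
      Real.norm_eq_abs]
    have h1 := hg1 x
    have h2 : |c x| ^ n ≤ 1 := pow_le_one₀ (abs_nonneg _) (hc1 x)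
    have h3 : ‖g x‖ * |c x| ^ n ≤ 1 := mul_le_one₀ h1 (by positivity) h2
    exact mul_le_of_le_one_right (by positivity) h3
  · exact Filter.Eventually.of_forall fun _ => Real.summable_pow_div_factorial _
  · exact integrable_const _
  · refine Filter.Eventually.of_forall fun x => ?_
    have := (NormedSpace.expSeries_div_hasSum_exp (z * (c x : ℂ))).mul_left (g x)
    rw [← Complex.exp_eq_exp_ℂ] at this
    refine this.congr_fun ?_
    intro n
    rw [mul_pow]; ring

lemma abs_repr_le_one (b : OrthonormalBasis (Fin d) ℝ (EuclideanSpace ℝ (Fin d))) (i : Fin d)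
    (ω : Metric.sphere (0 : EuclideanSpace ℝ (Fin d)) 1) :
    |b.repr (ω : EuclideanSpace ℝ (Fin d)) i| ≤ 1 := by
  have h := PiLp.norm_apply_le (b.repr (ω : EuclideanSpace ℝ (Fin d))) i
  simpa using h

lemma continuous_repr (b : OrthonormalBasis (Fin d) ℝ (EuclideanSpace ℝ (Fin d))) (i : Fin d) :
    Continuous fun ω : Metric.sphere (0 : EuclideanSpace ℝ (Fin d)) 1 =>
      b.repr (ω : EuclideanSpace ℝ (Fin d)) i := by
  have := b.repr.continuous
  fun_prop

/-- The Fourier transform of the surface measure of the sphere, at distance `r` from the origin. -/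
def sphereFourier (d : ℕ) (r : ℝ) : ℝ :=
  2 * Real.pi / r ^ mu d * besselJ (mu d) (2 * Real.pi * r)

/-- The Fourier transform of `u ↦ ω_u²` times the surface measure of the sphere, at distance `r`
from the origin and in a direction perpendicular to the unit vector `u`. -/
def sphereFourierPerp (d : ℕ) (r : ℝ) : ℝ :=
  1 / r ^ (mu d + 1) * besselJ (mu d + 1) (2 * Real.pi * r)

lemma besselJ_two_pi_mul (ν : ℝ) {r : ℝ} (hr : 0 < r) :
    besselJ ν (2 * Real.pi * r) = (Real.pi * r) ^ ν *
      ∑' m : ℕ, (-1 : ℝ) ^ m * (Real.pi * r) ^ (2 * m) /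
        ((m.factorial : ℝ) * Real.Gamma ((m : ℝ) + ν + 1)) := by
  have hπr : 0 < Real.pi * r := mul_pos Real.pi_pos hr
  rw [besselJ, ← tsum_mul_left]
  refine tsum_congr fun m => ?_
  rw [show 2 * Real.pi * r / 2 = Real.pi * r by ring, Real.rpow_add hπr,
    show (2 * (m : ℝ)) = ((2 * m : ℕ) : ℝ) by push_cast; ring, Real.rpow_natCast]
  ring

lemma sqrt_pi_pow (d : ℕ) : √Real.pi ^ d = Real.pi ^ (mu d + 1) := by
  rw [Real.sqrt_eq_rpow, ← Real.rpow_natCast, ← Real.rpow_mul Real.pi_pos.le, mu]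
  congr 1; ring

lemma rotated_pow (r : ℝ) (m : ℕ) :
    (-(2 * Real.pi * r * Complex.I)) ^ (2 * m) =
      (((-1) ^ m * 4 ^ m * (Real.pi * r) ^ (2 * m) : ℝ) : ℂ) := by
  rw [pow_mul, pow_mul, ← mul_pow, ← mul_pow, Complex.ofReal_pow]
  congr 1
  push_cast
  linear_combination (4 * Real.pi ^ 2 * r ^ 2 : ℂ) * Complex.I_sq

/-- Only even powers of the purely imaginary argument survive; these are real and carry the
alternating sign of the Bessel series. -/
lemma hasSum_even_terms {f : ℕ → ℝ} (hf : ∀ n, Odd n → f n = 0) {r : ℝ} {T : ℂ}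
    (h : HasSum (fun n : ℕ => (-(2 * Real.pi * r * Complex.I)) ^ n / n.factorial * (f n : ℂ)) T) :
    T = ((∑' m : ℕ, (-1) ^ m * 4 ^ m * (Real.pi * r) ^ (2 * m) / (2 * m).factorial * f (2 * m) : ℝ)
      : ℂ) := by
  have hinj : Function.Injective fun m : ℕ => 2 * m := fun a b hab => by
    simpa using hab
  have h' := (hinj.hasSum_iff (fun n hn => by
    have : Odd n := by
      rw [← Nat.not_even_iff_odd]
      rintro hev
      obtain ⟨m, rfl⟩ := hev.exists_two_nsmul
      exact hn ⟨m, by simp⟩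
    simp [hf n this])).2 h
  have h'' : HasSum (fun m : ℕ => (((-1) ^ m * 4 ^ m * (Real.pi * r) ^ (2 * m) /
      (2 * m).factorial * f (2 * m) : ℝ) : ℂ)) T := by
    refine h'.congr_fun fun m => ?_
    simp only [Function.comp_apply]
    rw [rotated_pow]
    push_cast
    ring
  rw [Complex.ofReal_tsum]
  exact h''.tsum_eq.symm

lemma gaussMoment_two_mul_div (m : ℕ) :
    gaussMoment (2 * m) / √Real.pi = ((2 * m).factorial : ℝ) / (4 ^ m * m.factorial) := by
  have : √Real.pi ≠ 0 := (Real.sqrt_pos.2 Real.pi_pos).ne'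
  rw [gaussMoment_two_mul]
  field_simp

/-- The identity holds term by term: the Gamma argument `(2m + d) / 2` is `m + μ + 1`, and the
prefactor `√π ^ d` is `π ^ (μ + 1)`. -/
lemma tsum_sphereMoment (d : ℕ) {r : ℝ} (hr : 0 < r) :
    ∑' m : ℕ, (-1) ^ m * 4 ^ m * (Real.pi * r) ^ (2 * m) / (2 * m).factorial *
      sphereMoment d (2 * m) = sphereFourier d r := by
  rw [sphereFourier, besselJ_two_pi_mul _ hr, ← mul_assoc, ← tsum_mul_left]
  refine tsum_congr fun m => ?_
  have h1 := (Nat.cast_pos (α := ℝ)).2 (2 * m).factorial_pos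
  have h2 := (Nat.cast_pos (α := ℝ)).2 m.factorial_pos
  have h3 := Real.rpow_pos_of_pos hr (mu d)
  rw [sphereMoment, gaussMoment_two_mul_div, sqrt_pi_pow, Real.mul_rpow Real.pi_pos.le hr.le,
    Real.rpow_add_one Real.pi_pos.ne',
    show (((2 * m : ℕ) : ℝ) + d) / 2 = m + mu d + 1 by rw [mu]; push_cast; ring]
  field_simp

lemma tsum_sphereMomentPerp (d : ℕ) {r : ℝ} (hr : 0 < r) :
    ∑' m : ℕ, (-1) ^ m * 4 ^ m * (Real.pi * r) ^ (2 * m) / (2 * m).factorial *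
      sphereMomentPerp d (2 * m) = sphereFourierPerp d r := by
  rw [sphereFourierPerp, besselJ_two_pi_mul _ hr, ← mul_assoc, ← tsum_mul_left]
  refine tsum_congr fun m => ?_
  have h1 := (Nat.cast_pos (α := ℝ)).2 (2 * m).factorial_pos
  have h2 := (Nat.cast_pos (α := ℝ)).2 m.factorial_pos
  have h3 := Real.rpow_pos_of_pos hr (mu d + 1)
  rw [sphereMomentPerp, gaussMoment_two_mul_div, sqrt_pi_pow, Real.mul_rpow Real.pi_pos.le hr.le,
    show (((2 * m : ℕ) : ℝ) + d) / 2 + 1 = m + (mu d + 1) + 1 by rw [mu]; push_cast; ring]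
  field_simp

section Basis

variable [NeZero d] (b : OrthonormalBasis (Fin d) ℝ (EuclideanSpace ℝ (Fin d))) (i₀ : Fin d)

lemma hasSum_sphereMoment (z : ℂ) :
    HasSum (fun n : ℕ => z ^ n / n.factorial * (sphereMoment d n : ℂ))
      (∫ ω, Complex.exp (z * b.repr (ω : EuclideanSpace ℝ (Fin d)) i₀) ∂sphereMeasure d) := by
  have h := hasSum_integral_mul_cexp (sphereMeasure d) (fun _ => 1) continuous_const
    _ (continuous_repr b i₀) (by simp) (abs_repr_le_one b i₀) z
  simp only [one_mul, ← Complex.ofReal_pow, integral_complex_ofReal,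
    integral_sphere_repr_pow] at h
  exact h

lemma hasSum_sphereMoment_quadratic (i j : Fin d) (z : ℂ) :
    HasSum (fun n : ℕ => z ^ n / n.factorial * ((sphereMomentPerp d n *
        ((if i = j then 1 else 0) + n * ((if i = i₀ then 1 else 0) * (if j = i₀ then 1 else 0)))
        : ℝ) : ℂ))
      (∫ ω, ((b.repr (ω : EuclideanSpace ℝ (Fin d)) i * b.repr (ω : EuclideanSpace ℝ (Fin d)) j
        : ℝ) : ℂ) * Complex.exp (z * b.repr (ω : EuclideanSpace ℝ (Fin d)) i₀)
        ∂sphereMeasure d) := by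
  have hi := continuous_repr b i
  have hj := continuous_repr b j
  have h := hasSum_integral_mul_cexp (sphereMeasure d)
    (fun ω => ((b.repr (ω : EuclideanSpace ℝ (Fin d)) i *
      b.repr (ω : EuclideanSpace ℝ (Fin d)) j : ℝ) : ℂ))
    (Complex.continuous_ofReal.comp (hi.mul hj)) _ (continuous_repr b i₀) (fun ω => by
      rw [Complex.norm_real, Real.norm_eq_abs, abs_mul]
      exact mul_le_one₀ (abs_repr_le_one b i ω) (abs_nonneg _) (abs_repr_le_one b j ω))
    (abs_repr_le_one b i₀) z
  simp only [← Complex.ofReal_pow, ← Complex.ofReal_mul, integral_complex_ofReal,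
    integral_sphere_repr_quadratic] at h
  exact h

lemma integral_sphere_cexp_repr {r : ℝ} (hr : 0 < r) :
    ∫ ω, Complex.exp (-(2 * Real.pi * r * Complex.I) * b.repr (ω : EuclideanSpace ℝ (Fin d)) i₀)
      ∂sphereMeasure d = sphereFourier d r := by
  rw [hasSum_even_terms (fun n => sphereMoment_odd) (hasSum_sphereMoment b i₀ _),
    tsum_sphereMoment d hr]

/-- Writing `pₙ` for the perpendicular moment and `mₙ` for the plain one, `n pₙ = mₙ - d pₙ`. The
weight `n` on the `i = j = i₀` part therefore turns into `Φ - d Ψ`, with no differentiation of the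
series. -/
lemma integral_sphere_quadratic_repr (hd : 2 ≤ d) (i j : Fin d) {r : ℝ} (hr : 0 < r) :
    ∫ ω, ((b.repr (ω : EuclideanSpace ℝ (Fin d)) i * b.repr (ω : EuclideanSpace ℝ (Fin d)) j
        : ℝ) : ℂ) * Complex.exp (-(2 * Real.pi * r * Complex.I) *
          b.repr (ω : EuclideanSpace ℝ (Fin d)) i₀) ∂sphereMeasure d =
      sphereFourierPerp d r * (if i = j then 1 else 0) +
        (sphereFourier d r - d * sphereFourierPerp d r) *
          ((if i = i₀ then 1 else 0) * (if j = i₀ then 1 else 0)) := by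
  have : Nontrivial (Fin d) := Fin.nontrivial_iff_two_le.2 hd
  -- A direction perpendicular to `i₀` isolates the series of the `pₙ`, and so shows that it
  -- converges to `Ψ`.
  obtain ⟨i₁, h₁⟩ := exists_ne i₀
  set z : ℂ := -(2 * Real.pi * r * Complex.I) with hz
  have hperp := hasSum_sphereMoment_quadratic b i₀ i₁ i₁ z
  simp only [if_neg h₁, if_true, mul_zero, add_zero, mul_one] at hperp
  have hpval := hperp
  rw [hasSum_even_terms (fun n => sphereMomentPerp_odd) hperp, tsum_sphereMomentPerp d hr] at hpval
  have hΦ := hasSum_sphereMoment b i₀ z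
  rw [integral_sphere_cexp_repr b i₀ hr] at hΦ
  refine (hasSum_sphereMoment_quadratic b i₀ i j z).unique ?_
  refine HasSum.congr_fun ((hpval.mul_right (if i = j then 1 else 0)).add
    ((hΦ.sub (hpval.mul_left (d : ℂ))).mul_right
      ((if i = i₀ then 1 else 0) * (if j = i₀ then 1 else 0)))) fun n => ?_
  rw [← add_mul_sphereMomentPerp]
  push_cast [apply_ite Complex.ofReal]
  ring

end Basis

lemma exists_orthonormalBasis_apply_eq [NeZero d] {e : EuclideanSpace ℝ (Fin d)} (he : ‖e‖ = 1) :
    ∃ (b : OrthonormalBasis (Fin d) ℝ (EuclideanSpace ℝ (Fin d))), b 0 = e := by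
  have h : Orthonormal ℝ (({0} : Set (Fin d)).domRestrict fun _ => e) := by
    refine ⟨fun _ => he, fun i j hij => (hij (Subsingleton.elim _ _)).elim⟩
  obtain ⟨b, hb⟩ := h.exists_orthonormalBasis_extension_of_card_eq (by simp)
  exact ⟨b, hb 0 rfl⟩

lemma integral_sphere_cexp_inner [NeZero d] {e : EuclideanSpace ℝ (Fin d)} (he : ‖e‖ = 1) {r : ℝ}
    (hr : 0 < r) :
    ∫ ω, Complex.exp (-(2 * Real.pi * r * Complex.I) *
      (inner ℝ e (ω : EuclideanSpace ℝ (Fin d)) : ℝ)) ∂sphereMeasure d = sphereFourier d r := by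
  obtain ⟨b, rfl⟩ := exists_orthonormalBasis_apply_eq he
  simpa only [b.repr_apply_apply] using integral_sphere_cexp_repr b 0 hr

/-- Expand `u` and `v` in an orthonormal basis whose vector of index `0` is `e`; Parseval
reassembles the Kronecker deltas into `inner ℝ u v`. -/
lemma integral_sphere_quadratic_inner [NeZero d] (hd : 2 ≤ d) {e : EuclideanSpace ℝ (Fin d)}
    (he : ‖e‖ = 1) (u v : EuclideanSpace ℝ (Fin d)) {r : ℝ} (hr : 0 < r) :
    ∫ ω, ((inner ℝ u (ω : EuclideanSpace ℝ (Fin d)) * inner ℝ v (ω : EuclideanSpace ℝ (Fin d))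
        : ℝ) : ℂ) * Complex.exp (-(2 * Real.pi * r * Complex.I) *
          (inner ℝ e (ω : EuclideanSpace ℝ (Fin d)) : ℝ)) ∂sphereMeasure d =
      ((sphereFourierPerp d r * inner ℝ u v + (sphereFourier d r - d * sphereFourierPerp d r) *
        (inner ℝ u e * inner ℝ v e) : ℝ) : ℂ) := by
  obtain ⟨b, rfl⟩ := exists_orthonormalBasis_apply_eq he
  have hexp : ∀ ω : Metric.sphere (0 : EuclideanSpace ℝ (Fin d)) 1,
      ((inner ℝ u (ω : EuclideanSpace ℝ (Fin d)) * inner ℝ v (ω : EuclideanSpace ℝ (Fin d))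
        : ℝ) : ℂ) * Complex.exp (-(2 * Real.pi * r * Complex.I) *
          (inner ℝ (b 0) (ω : EuclideanSpace ℝ (Fin d)) : ℝ)) =
      ∑ i, ∑ j, (inner ℝ u (b i) * inner ℝ v (b j) : ℂ) *
        (((b.repr (ω : EuclideanSpace ℝ (Fin d)) i * b.repr (ω : EuclideanSpace ℝ (Fin d)) j
        : ℝ) : ℂ) * Complex.exp (-(2 * Real.pi * r * Complex.I) *
          b.repr (ω : EuclideanSpace ℝ (Fin d)) 0)) := by
    intro ω
    rw [← b.sum_inner_mul_inner u, ← b.sum_inner_mul_inner v, Finset.sum_mul_sum]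
    simp only [b.repr_apply_apply]
    push_cast
    simp only [Finset.sum_mul]
    refine Finset.sum_congr rfl fun i _ => Finset.sum_congr rfl fun j _ => ?_
    ring
  have hint : ∀ i j, Integrable (fun ω : Metric.sphere (0 : EuclideanSpace ℝ (Fin d)) 1 =>
      (inner ℝ u (b i) * inner ℝ v (b j) : ℂ) *
        (((b.repr (ω : EuclideanSpace ℝ (Fin d)) i * b.repr (ω : EuclideanSpace ℝ (Fin d)) j
        : ℝ) : ℂ) * Complex.exp (-(2 * Real.pi * r * Complex.I) *
          b.repr (ω : EuclideanSpace ℝ (Fin d)) 0))) (sphereMeasure d) := by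
    intro i j
    refine Continuous.integrable_of_hasCompactSupport ?_ (HasCompactSupport.of_compactSpace _)
    have hi := continuous_repr b i
    have hj := continuous_repr b j
    have h0 := continuous_repr b 0
    fun_prop
  simp only [hexp]
  rw [integral_finsetSum _ fun i _ => integrable_finsetSum _ fun j _ => hint i j]
  simp only [integral_finsetSum _ fun j _ => hint _ j, integral_const_mul,
    integral_sphere_quadratic_repr b 0 hd _ _ hr, mul_add, Finset.sum_add_distrib]
  rw [← b.sum_inner_mul_inner u v]
  push_cast
  congr 1
  · simp only [mul_ite, mul_one, mul_zero, Finset.sum_ite_eq, Finset.mem_univ, if_true,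
      Finset.mul_sum]
    refine Finset.sum_congr rfl fun i _ => ?_
    rw [real_inner_comm v]
    ring
  · simp
    ring

/-! ### Boundedness and continuity of the sphere transforms -/

lemma continuous_integral_mul_cexp {X : Type*} [MeasurableSpace X] [TopologicalSpace X]
    [OpensMeasurableSpace X] [SecondCountableTopology X] (σ : Measure X)
    [IsFiniteMeasure σ] (g : X → ℂ) (hg : Continuous g) (c : X → ℝ) (hc : Continuous c)
    (hg1 : ∀ x, ‖g x‖ ≤ 1) :
    Continuous (fun r : ℝ => ∫ x, g x * Complex.exp (-(2 * Real.pi * r * Complex.I) * c x) ∂σ) ∧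
    ∀ r : ℝ, ‖∫ x, g x * Complex.exp (-(2 * Real.pi * r * Complex.I) * c x) ∂σ‖ ≤ σ.real univ := by
  have hnorm : ∀ (r : ℝ) (x : X),
      ‖g x * Complex.exp (-(2 * Real.pi * r * Complex.I) * c x)‖ ≤ 1 := by
    intro r x
    rw [norm_mul, show -(2 * Real.pi * r * Complex.I) * (c x : ℂ) =
      ((-(2 * Real.pi * r * c x) : ℝ) : ℂ) * Complex.I by push_cast; ring,
      Complex.norm_exp_ofReal_mul_I, mul_one]
    exact hg1 x
  refine ⟨?_, fun r => ?_⟩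
  · refine continuous_of_dominated (bound := fun _ => 1) (fun r => ?_)
      (fun r => Filter.Eventually.of_forall (hnorm r)) (integrable_const _)
      (Filter.Eventually.of_forall fun x => by fun_prop)
    exact Continuous.aestronglyMeasurable (by fun_prop)
  · simpa using norm_integral_le_of_norm_le_const (μ := σ)
      (Filter.Eventually.of_forall (hnorm r))

/-- As a Fourier integral of a finite measure the function is continuous and bounded by the total
mass, so no Bessel asymptotics at `0` or at infinity are needed for absolute convergence. -/
lemma sphereFourier_bounded [NeZero d] :
    ContinuousOn (sphereFourier d) (Ioi 0) ∧
      ∃ C, ∀ r ∈ Ioi (0 : ℝ), ‖sphereFourier d r‖ ≤ C := by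
  let b := EuclideanSpace.basisFun (Fin d) ℝ
  obtain ⟨hc, hb⟩ := continuous_integral_mul_cexp (sphereMeasure d) (fun _ => 1)
    continuous_const _ (continuous_repr b 0) (by simp)
  simp only [one_mul] at hc hb
  refine ⟨?_, (sphereMeasure d).real univ, fun r hr => ?_⟩
  · refine (Complex.continuous_re.comp hc).continuousOn.congr fun r hr => ?_
    simp only [Function.comp_apply]
    rw [integral_sphere_cexp_repr b 0 hr, Complex.ofReal_re]
  · rw [← Complex.norm_real, ← integral_sphere_cexp_repr b 0 hr]
    exact hb r

lemma sphereFourierPerp_bounded [NeZero d] (hd : 2 ≤ d) :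
    ContinuousOn (sphereFourierPerp d) (Ioi 0) ∧
      ∃ C, ∀ r ∈ Ioi (0 : ℝ), ‖sphereFourierPerp d r‖ ≤ C := by
  have : Nontrivial (Fin d) := Fin.nontrivial_iff_two_le.2 hd
  obtain ⟨i, hi⟩ := exists_ne (0 : Fin d)
  let b := EuclideanSpace.basisFun (Fin d) ℝ
  have hcont := continuous_repr b i
  obtain ⟨hc, hb⟩ := continuous_integral_mul_cexp (sphereMeasure d)
    (fun ω => ((b.repr (ω : EuclideanSpace ℝ (Fin d)) i *
      b.repr (ω : EuclideanSpace ℝ (Fin d)) i : ℝ) : ℂ))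
    (Complex.continuous_ofReal.comp (hcont.mul hcont)) _ (continuous_repr b 0) (fun ω => by
      rw [Complex.norm_real, Real.norm_eq_abs, abs_mul]
      exact mul_le_one₀ (abs_repr_le_one b i ω) (abs_nonneg _) (abs_repr_le_one b i ω))
  have hval : ∀ r ∈ Ioi (0 : ℝ), _ = (sphereFourierPerp d r : ℂ) := fun r hr => by
    have h := integral_sphere_quadratic_repr b 0 hd i i hr
    simpa only [if_true, if_neg hi, mul_zero, add_zero, mul_one] using h
  refine ⟨?_, (sphereMeasure d).real univ, fun r hr => ?_⟩
  · refine (Complex.continuous_re.comp hc).continuousOn.congr fun r hr => ?_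
    simp only [Function.comp_apply]
    rw [hval r hr, Complex.ofReal_re]
  · rw [← Complex.norm_real, ← hval r hr]
    exact hb r

lemma integrableOn_mul_comp_mul {f g : ℝ → ℝ} (hf : IntegrableOn f (Ioi 0))
    (hg : ContinuousOn g (Ioi 0) ∧ ∃ C, ∀ r ∈ Ioi (0 : ℝ), ‖g r‖ ≤ C) {s : ℝ} (hs : 0 < s) :
    IntegrableOn (fun t => f t * g (s * t)) (Ioi 0) := by
  obtain ⟨hc, C, hC⟩ := hg
  have hmaps : MapsTo (fun t : ℝ => s * t) (Ioi 0) (Ioi 0) := fun t ht => mul_pos hs ht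
  refine Integrable.mul_bdd (c := C) hf
    ((hc.comp (by fun_prop) hmaps).aestronglyMeasurable measurableSet_Ioi) ?_
  filter_upwards [ae_restrict_mem measurableSet_Ioi] with t ht using hC _ (hmaps ht)

/-! ### The coefficient map in terms of the sphere transforms -/

lemma pow_eq_rpow_mul_rpow (hd : 1 ≤ d) {t : ℝ} (ht : 0 < t) :
    t ^ (d - 1) = t ^ mu d * t ^ (mu d + 1) := by
  rw [← Real.rpow_natCast, ← Real.rpow_add ht, Nat.cast_sub hd, mu]
  congr 1
  push_cast
  ring

lemma mul_besselJ_eq_sphereFourier (hd : 1 ≤ d) {s t : ℝ} (hs : 0 < s) (ht : 0 < t) (c : ℝ) :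
    t ^ (mu d + 1) * c * besselJ (mu d) (2 * Real.pi * s * t) =
      s ^ mu d / (2 * Real.pi) * (t ^ (d - 1) * c * sphereFourier d (s * t)) := by
  have h1 := Real.rpow_pos_of_pos hs (mu d)
  have h2 := Real.rpow_pos_of_pos ht (mu d)
  rw [pow_eq_rpow_mul_rpow hd ht, sphereFourier, Real.mul_rpow hs.le ht.le, mul_assoc (2 * Real.pi)]
  field_simp

lemma mul_besselJ_eq_sphereFourierPerp (hd : 1 ≤ d) {s t : ℝ} (hs : 0 < s) (ht : 0 < t) (c : ℝ) :
    t ^ mu d * c * besselJ (mu d + 1) (2 * Real.pi * s * t) =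
      s ^ (mu d + 1) * (t ^ (d - 1) * c * sphereFourierPerp d (s * t)) := by
  have h1 := Real.rpow_pos_of_pos hs (mu d + 1)
  have h2 := Real.rpow_pos_of_pos ht (mu d + 1)
  rw [pow_eq_rpow_mul_rpow hd ht, sphereFourierPerp, Real.mul_rpow hs.le ht.le,
    mul_assoc (2 * Real.pi)]
  field_simp

lemma coeffMapConverges_of_integrableOn (hd : 2 ≤ d) {a b : ℝ → ℝ}
    (ha : IntegrableOn (fun t => t ^ (d - 1) * a t) (Ioi 0))
    (hb : IntegrableOn (fun t => t ^ (d - 1) * b t) (Ioi 0)) {s : ℝ} (hs : 0 < s) :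
    CoeffMapConverges d (a, b) s := by
  have : NeZero d := ⟨by omega⟩
  have hab : IntegrableOn (fun t => t ^ (d - 1) * (a t - b t)) (Ioi 0) := by
    simpa only [mul_sub] using! ha.sub hb
  refine ⟨?_, ?_, ?_⟩
  · exact ((integrableOn_mul_comp_mul ha (sphereFourier_bounded (d := d)) hs).const_mul _).congr
      ((ae_restrict_mem measurableSet_Ioi).mono fun t ht => (mul_besselJ_eq_sphereFourier (by omega) hs ht _).symm)
  · exact ((integrableOn_mul_comp_mul hb (sphereFourier_bounded (d := d)) hs).const_mul _).congr
      ((ae_restrict_mem measurableSet_Ioi).mono fun t ht => (mul_besselJ_eq_sphereFourier (by omega) hs ht _).symm)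
  · exact ((integrableOn_mul_comp_mul hab (sphereFourierPerp_bounded hd) hs).const_mul _).congr
      ((ae_restrict_mem measurableSet_Ioi).mono fun t ht => (mul_besselJ_eq_sphereFourierPerp (by omega) hs ht _).symm)

lemma two_mul_mu_add_one (d : ℕ) : 2 * mu d + 1 = d - 1 := by
  rw [mu]; ring

/-- The powers of `s` and the factors `2π` are absorbed into the sphere transforms, and the weight
becomes the polar density `t ^ (d - 1)`. -/
lemma coeffMap_eq (hd : 2 ≤ d) (a b : ℝ → ℝ) {s : ℝ} (hs : 0 < s) :
    (coeffMap d (a, b)).1 s =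
      (∫ t in Ioi (0 : ℝ), t ^ (d - 1) * a t * sphereFourier d (s * t)) -
        (d - 1) * ∫ t in Ioi (0 : ℝ), t ^ (d - 1) * (a t - b t) * sphereFourierPerp d (s * t) ∧
    (coeffMap d (a, b)).2 s =
      (∫ t in Ioi (0 : ℝ), t ^ (d - 1) * b t * sphereFourier d (s * t)) +
        ∫ t in Ioi (0 : ℝ), t ^ (d - 1) * (a t - b t) * sphereFourierPerp d (s * t) := by
  have h1 := Real.rpow_pos_of_pos hs (mu d)
  have h2 := Real.rpow_pos_of_pos hs (mu d + 1)
  have e1 : ∀ c : ℝ → ℝ,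
      ∫ t in Ioi (0 : ℝ), t ^ (mu d + 1) * c t * besselJ (mu d) (2 * Real.pi * s * t) =
      s ^ mu d / (2 * Real.pi) *
        ∫ t in Ioi (0 : ℝ), t ^ (d - 1) * c t * sphereFourier d (s * t) := fun c => by
    rw [← integral_const_mul]
    exact setIntegral_congr_fun measurableSet_Ioi fun t ht =>
      mul_besselJ_eq_sphereFourier (by omega) hs ht _
  have e2 : ∫ t in Ioi (0 : ℝ), t ^ mu d * (a t - b t) *
        besselJ (mu d + 1) (2 * Real.pi * s * t) =
      s ^ (mu d + 1) *
        ∫ t in Ioi (0 : ℝ), t ^ (d - 1) * (a t - b t) * sphereFourierPerp d (s * t) := by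
    rw [← integral_const_mul]
    exact setIntegral_congr_fun measurableSet_Ioi fun t ht =>
      mul_besselJ_eq_sphereFourierPerp (by omega) hs ht _
  simp only [coeffMap, e1, e2, two_mul_mu_add_one]
  constructor
  · field_simp
  · field_simp

/-! ### Fields of radial matrices -/

lemma hasCoefficients_iff {𝕜 : Type*} [RCLike 𝕜]
    {F : EuclideanSpace ℝ (Fin d) → Matrix (Fin d) (Fin d) 𝕜} {a b : ℝ → ℝ} :
    HasCoefficients F a b ↔ ∀ x : EuclideanSpace ℝ (Fin d), x ≠ 0 → ∀ i j,
      F x i j = ((b ‖x‖ * (if i = j then 1 else 0) +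
        (a ‖x‖ - b ‖x‖) * (x i * x j / ‖x‖ ^ 2) : ℝ) : 𝕜) := by
  refine forall₂_congr fun x _ => ?_
  rw [← Matrix.ext_iff]
  refine forall₂_congr fun i j => ?_
  have : (a ‖x‖ • prPar x + b ‖x‖ • prPerp x) i j = b ‖x‖ * (if i = j then 1 else 0) +
        (a ‖x‖ - b ‖x‖) * (x i * x j / ‖x‖ ^ 2) := by
    simp only [prPerp, prPar, Matrix.add_apply, Matrix.smul_apply, Matrix.sub_apply,
      Matrix.one_apply, Matrix.of_apply, smul_eq_mul]
    ring
  rw [Matrix.map_apply, this]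

lemma ae_ne_zero [NeZero d] : ∀ᵐ x : EuclideanSpace ℝ (Fin d), x ≠ 0 :=
  compl_mem_ae_iff.2 (measure_singleton 0)

lemma integral_const_mul_add_const_mul {X : Type*} [MeasurableSpace X] {𝕜 : Type*} [RCLike 𝕜]
    {m : Measure X} {f g : X → 𝕜} (hf : Integrable f m) (hg : Integrable g m) (α β : 𝕜) :
    ∫ x, (α * f x + β * g x) ∂m = α * ∫ x, f x ∂m + β * ∫ x, g x ∂m := by
  rw [integral_add (hf.const_mul _) (hg.const_mul _), integral_const_mul, integral_const_mul]

lemma integral_linear_combination₃ {X : Type*} [MeasurableSpace X] {𝕜 : Type*} [RCLike 𝕜]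
    {m : Measure X} {f g h : X → 𝕜} (hf : Integrable f m) (hg : Integrable g m)
    (hh : Integrable h m) (α β γ : 𝕜) :
    ∫ x, (α * f x + β * g x + γ * h x) ∂m =
      α * ∫ x, f x ∂m + β * ∫ x, g x ∂m + γ * ∫ x, h x ∂m := by
  have hfg : Integrable (fun x => α * f x + β * g x) m := (hf.const_mul _).add (hg.const_mul _)
  rw [integral_add hfg (hh.const_mul _), integral_const_mul_add_const_mul hf hg, integral_const_mul]

lemma integrable_entry_mul {f : EuclideanSpace ℝ (Fin d) → ℝ} (hf : Integrable f) (i j : Fin d) :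
    Integrable fun x : EuclideanSpace ℝ (Fin d) => f x * (x i * x j / ‖x‖ ^ 2) := by
  refine hf.mul_bdd (c := 1) (Measurable.aestronglyMeasurable (by fun_prop)) (Filter.Eventually.of_forall fun x => ?_)
  rw [norm_div, norm_mul, norm_pow, norm_norm]
  refine div_le_one_of_le₀ ?_ (by positivity)
  rw [sq]
  exact mul_le_mul (PiLp.norm_apply_le x i) (PiLp.norm_apply_le x j) (norm_nonneg _)
    (norm_nonneg _)

lemma sum_mul_self_div_norm_sq {x : EuclideanSpace ℝ (Fin d)} (hx : x ≠ 0) :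
    ∑ i, x i * x i / ‖x‖ ^ 2 = 1 := by
  rw [← Finset.sum_div, EuclideanSpace.norm_sq_eq, div_eq_one_iff_eq]
  · simp [sq]
  · rw [← EuclideanSpace.norm_sq_eq]
    have := norm_pos_iff.2 hx
    positivity

/-- Contracting with the rank-one projection annihilates the perpendicular part and has value `1` on
the projection itself. -/
lemma sum_entry_mul {x : EuclideanSpace ℝ (Fin d)} (hx : x ≠ 0) (α β : ℝ) :
    ∑ i, ∑ j, (β * (if i = j then 1 else 0) + (α - β) * (x i * x j / ‖x‖ ^ 2)) *
      (x i * x j / ‖x‖ ^ 2) = α := by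
  have hprod : ∑ i, ∑ j, (x i * x j / ‖x‖ ^ 2) * (x i * x j / ‖x‖ ^ 2) = 1 := by
    rw [← one_mul (1 : ℝ), ← sum_mul_self_div_norm_sq hx, Finset.sum_mul_sum]
    refine Finset.sum_congr rfl fun i _ => Finset.sum_congr rfl fun j _ => ?_
    ring
  calc _ = β * ∑ i, (x i * x i / ‖x‖ ^ 2) + (α - β) *
        ∑ i, ∑ j, (x i * x j / ‖x‖ ^ 2) * (x i * x j / ‖x‖ ^ 2) := by
        simp only [add_mul, Finset.sum_add_distrib, Finset.mul_sum]
        congr 1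
        · simp
        · simp only [mul_assoc]
    _ = α := by rw [sum_mul_self_div_norm_sq hx, hprod]; ring

lemma sum_entry_diag {x : EuclideanSpace ℝ (Fin d)} (hx : x ≠ 0) (α β : ℝ) :
    ∑ i, (β + (α - β) * (x i * x i / ‖x‖ ^ 2)) = α + (d - 1) * β := by
  rw [Finset.sum_add_distrib, ← Finset.mul_sum, sum_mul_self_div_norm_sq hx]
  simp
  ring

lemma natCast_sub_one_ne_zero (hd : 2 ≤ d) : (d : ℝ) - 1 ≠ 0 := by
  have : (2 : ℝ) ≤ d := by exact_mod_cast hd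
  linarith

/-- Two linear functionals recover the coefficients: contraction with the projection gives `α`, the
trace gives `α + (d - 1) β`, and `d ≠ 1`. -/
lemma eq_of_entry_eq (hd : 2 ≤ d) {x : EuclideanSpace ℝ (Fin d)} (hx : x ≠ 0) {α β α' β' : ℝ}
    (h : ∀ i j, β * (if i = j then 1 else 0) + (α - β) * (x i * x j / ‖x‖ ^ 2) =
      β' * (if i = j then 1 else 0) + (α' - β') * (x i * x j / ‖x‖ ^ 2)) :
    α = α' ∧ β = β' := by
  have h1 := sum_entry_mul hx α β
  have h2 := sum_entry_diag hx α β
  have hdiag : ∀ i, β + (α - β) * (x i * x i / ‖x‖ ^ 2) =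
      β' + (α' - β') * (x i * x i / ‖x‖ ^ 2) := fun i => by simpa using h i i
  simp only [h] at h1
  simp only [hdiag] at h2
  rw [sum_entry_mul hx] at h1
  rw [sum_entry_diag hx, h1] at h2
  exact ⟨h1.symm, (mul_left_cancel₀ (natCast_sub_one_ne_zero hd) (add_left_cancel h2)).symm⟩

/-- The same two functionals express `a` and `b` through the entries of `k` with bounded
multipliers, so integrability passes from entries to coefficients. -/
lemma integrable_coefficients (hd : 2 ≤ d)
    {k : EuclideanSpace ℝ (Fin d) → Matrix (Fin d) (Fin d) ℝ} {a b : ℝ → ℝ}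
    (hk : HasCoefficients k a b) (hi : MatIntegrable k) :
    Integrable (fun x : EuclideanSpace ℝ (Fin d) => a ‖x‖) ∧
      Integrable (fun x : EuclideanSpace ℝ (Fin d) => b ‖x‖) := by
  have : NeZero d := ⟨by omega⟩
  rw [hasCoefficients_iff] at hk
  simp only [RCLike.ofReal_real_eq_id, id] at hk
  have ha : Integrable (fun x : EuclideanSpace ℝ (Fin d) => a ‖x‖) := by
    have h : Integrable fun x : EuclideanSpace ℝ (Fin d) =>
        ∑ i, ∑ j, k x i j * (x i * x j / ‖x‖ ^ 2) :=
      integrable_finsetSum _ fun i _ => integrable_finsetSum _ fun j _ =>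
        integrable_entry_mul (hi i j) i j
    refine h.congr ?_
    filter_upwards [ae_ne_zero] with x hx
    simp only [hk x hx, sum_entry_mul hx]
  refine ⟨ha, ?_⟩
  have h : Integrable fun x : EuclideanSpace ℝ (Fin d) =>
      ((∑ i, k x i i) - a ‖x‖) / (d - 1) :=
    ((integrable_finsetSum _ fun i _ => hi i i).sub ha).div_const _
  refine h.congr ?_
  filter_upwards [ae_ne_zero] with x hx
  have hd1 := natCast_sub_one_ne_zero hd
  simp only [hk x hx, if_true, mul_one, sum_entry_diag hx]
  field_simp
  ring

lemma integrableOn_coefficients (hd : 2 ≤ d)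
    {k : EuclideanSpace ℝ (Fin d) → Matrix (Fin d) (Fin d) ℝ} {a b : ℝ → ℝ}
    (hk : HasCoefficients k a b) (hi : MatIntegrable k) :
    IntegrableOn (fun t => t ^ (d - 1) * a t) (Ioi 0) ∧
      IntegrableOn (fun t => t ^ (d - 1) * b t) (Ioi 0) := by
  have : Nonempty (Fin d) := ⟨⟨0, by omega⟩⟩
  obtain ⟨ha, hb⟩ := integrable_coefficients hd hk hi
  rw [integrable_fun_norm_addHaar, finrank_euclideanSpace_fin] at ha hb
  exact ⟨ha, hb⟩

lemma integral_sphere_entry [NeZero d] (hd : 2 ≤ d) (α β : ℝ) {ξ : EuclideanSpace ℝ (Fin d)}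
    (hξ : ξ ≠ 0) (i j : Fin d) {r : ℝ} (hr : 0 < r) :
    ∫ ω, Complex.exp (((-2 * Real.pi * inner ℝ (r • (ω : EuclideanSpace ℝ (Fin d))) ξ : ℝ) : ℂ) *
        Complex.I) * ((β * (if i = j then 1 else 0) + (α - β) *
          ((ω : EuclideanSpace ℝ (Fin d)) i * (ω : EuclideanSpace ℝ (Fin d)) j) : ℝ) : ℂ)
          ∂sphereMeasure d =
      ((β * (if i = j then 1 else 0) * sphereFourier d (‖ξ‖ * r) + (α - β) *
        (sphereFourierPerp d (‖ξ‖ * r) * (if i = j then 1 else 0) +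
          (sphereFourier d (‖ξ‖ * r) - d * sphereFourierPerp d (‖ξ‖ * r)) *
            (ξ i * ξ j / ‖ξ‖ ^ 2)) : ℝ) : ℂ) := by
  have hs : 0 < ‖ξ‖ := norm_pos_iff.2 hξ
  set e : EuclideanSpace ℝ (Fin d) := ‖ξ‖⁻¹ • ξ with he
  have he1 : ‖e‖ = 1 := by rw [he, norm_smul, norm_inv, norm_norm, inv_mul_cancel₀ hs.ne']
  let u : Fin d → EuclideanSpace ℝ (Fin d) := fun i => EuclideanSpace.single i 1
  have hu : ∀ i (x : EuclideanSpace ℝ (Fin d)), inner ℝ (u i) x = x i := fun i x => by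
    simp [u, EuclideanSpace.inner_single_left]
  have huu : inner ℝ (u i) (u j) = if i = j then 1 else 0 := by
    rw [hu]; simp [u]
  have h0 := integral_sphere_cexp_inner he1 (mul_pos hs hr)
  have h2 := integral_sphere_quadratic_inner hd he1 (u i) (u j) (mul_pos hs hr)
  have hexp : ∀ ω : EuclideanSpace ℝ (Fin d),
      ((-2 * Real.pi * inner ℝ (r • ω) ξ : ℝ) : ℂ) * Complex.I =
      -(2 * Real.pi * (‖ξ‖ * r : ℝ) * Complex.I) * (inner ℝ e ω : ℝ) := by
    intro ω
    rw [he, real_inner_smul_left, real_inner_smul_left, real_inner_comm]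
    have : ((‖ξ‖ : ℝ) : ℂ) ≠ 0 := by exact_mod_cast hs.ne'
    push_cast
    field_simp
  have hcont : Continuous fun ω : Metric.sphere (0 : EuclideanSpace ℝ (Fin d)) 1 =>
      Complex.exp (-(2 * Real.pi * (‖ξ‖ * r : ℝ) * Complex.I) *
        (inner ℝ e (ω : EuclideanSpace ℝ (Fin d)) : ℝ)) := by fun_prop
  have hcont2 : Continuous fun ω : Metric.sphere (0 : EuclideanSpace ℝ (Fin d)) 1 =>
      ((inner ℝ (u i) (ω : EuclideanSpace ℝ (Fin d)) *
        inner ℝ (u j) (ω : EuclideanSpace ℝ (Fin d)) : ℝ) : ℂ) := by fun_prop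
  have hint1 := hcont.integrable_of_hasCompactSupport (μ := sphereMeasure d)
    (HasCompactSupport.of_compactSpace _)
  have hint2 : Integrable (fun ω : Metric.sphere (0 : EuclideanSpace ℝ (Fin d)) 1 =>
      ((inner ℝ (u i) (ω : EuclideanSpace ℝ (Fin d)) *
        inner ℝ (u j) (ω : EuclideanSpace ℝ (Fin d)) : ℝ) : ℂ) *
      Complex.exp (-(2 * Real.pi * (‖ξ‖ * r : ℝ) * Complex.I) *
        (inner ℝ e (ω : EuclideanSpace ℝ (Fin d)) : ℝ))) (sphereMeasure d) := (hcont2.mul hcont).integrable_of_hasCompactSupport (μ := sphereMeasure d)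
    (HasCompactSupport.of_compactSpace _)
  have hsplit : ∀ ω : Metric.sphere (0 : EuclideanSpace ℝ (Fin d)) 1,
      Complex.exp (((-2 * Real.pi * inner ℝ (r • (ω : EuclideanSpace ℝ (Fin d))) ξ : ℝ) : ℂ) *
        Complex.I) * ((β * (if i = j then 1 else 0) + (α - β) *
          ((ω : EuclideanSpace ℝ (Fin d)) i * (ω : EuclideanSpace ℝ (Fin d)) j) : ℝ) : ℂ) =
      ((β * (if i = j then 1 else 0) : ℝ) : ℂ) *
        Complex.exp (-(2 * Real.pi * (‖ξ‖ * r : ℝ) * Complex.I) *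
          (inner ℝ e (ω : EuclideanSpace ℝ (Fin d)) : ℝ)) +
      ((α - β : ℝ) : ℂ) * (((inner ℝ (u i) (ω : EuclideanSpace ℝ (Fin d)) *
        inner ℝ (u j) (ω : EuclideanSpace ℝ (Fin d)) : ℝ) : ℂ) *
        Complex.exp (-(2 * Real.pi * (‖ξ‖ * r : ℝ) * Complex.I) *
          (inner ℝ e (ω : EuclideanSpace ℝ (Fin d)) : ℝ))) := by
    intro ω
    rw [hexp, hu, hu, Complex.ofReal_add, Complex.ofReal_mul (α - β)]
    ring
  simp only [hsplit]
  rw [integral_const_mul_add_const_mul hint1 hint2, h0, h2, huu, hu, hu, ← Complex.ofReal_mul, ← Complex.ofReal_mul,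
    ← Complex.ofReal_add]
  congr 4
  simp only [he, PiLp.smul_apply, smul_eq_mul]
  field_simp

/-- The Fourier transform of an integrable radial matrix field is a radial matrix field, with
coefficients given by the coefficient map. -/
theorem hasCoefficients_matFourier (hd : 2 ≤ d)
    {k : EuclideanSpace ℝ (Fin d) → Matrix (Fin d) (Fin d) ℝ} {a b : ℝ → ℝ}
    (hk : HasCoefficients k a b) (hi : MatIntegrable k) :
    HasCoefficients (matFourier k) (coeffMap d (a, b)).1 (coeffMap d (a, b)).2 := by
  have : NeZero d := ⟨by omega⟩
  obtain ⟨ha, hb⟩ := integrableOn_coefficients hd hk hi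
  have hab : IntegrableOn (fun t => t ^ (d - 1) * (a t - b t)) (Ioi 0) := by
    simpa only [mul_sub] using! ha.sub hb
  rw [hasCoefficients_iff] at hk ⊢
  simp only [RCLike.ofReal_real_eq_id, id] at hk
  intro ξ hξ i j
  have hs : 0 < ‖ξ‖ := norm_pos_iff.2 hξ
  have ia := integrableOn_mul_comp_mul ha (sphereFourier_bounded (d := d)) hs
  have ib := integrableOn_mul_comp_mul hb (sphereFourier_bounded (d := d)) hs
  have iab := integrableOn_mul_comp_mul hab (sphereFourierPerp_bounded hd) hs
  obtain ⟨c1, c2⟩ := coeffMap_eq hd a b hs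
  rw [c1, c2, matFourier, Matrix.of_apply, Real.fourier_eq']
  rw [integral_eq_integral_Ioi_sphere]
  swap
  · have h := (Real.fourierIntegral_convergent_iff ξ).2 ((hi i j).ofReal (𝕜 := ℂ))
    simp only [Circle.smul_def, Real.fourierChar_apply, mul_neg] at h
    simp only [neg_mul]
    exact h
  have key : ∀ r ∈ Ioi (0 : ℝ), r ^ (d - 1) • ∫ ω, Complex.exp (((-2 * Real.pi *
        inner ℝ (r • (ω : EuclideanSpace ℝ (Fin d))) ξ : ℝ) : ℂ) * Complex.I) •
          (k (r • (ω : EuclideanSpace ℝ (Fin d))) i j : ℂ) ∂sphereMeasure d =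
      (((if i = j then 1 else 0) * (r ^ (d - 1) * b r * sphereFourier d (‖ξ‖ * r)) +
        ((if i = j then 1 else 0) - d * (ξ i * ξ j / ‖ξ‖ ^ 2)) *
          (r ^ (d - 1) * (a r - b r) * sphereFourierPerp d (‖ξ‖ * r)) +
        (ξ i * ξ j / ‖ξ‖ ^ 2) * (r ^ (d - 1) * a r * sphereFourier d (‖ξ‖ * r) -
          r ^ (d - 1) * b r * sphereFourier d (‖ξ‖ * r)) : ℝ) : ℂ) := by
    intro r hr
    have hr0 : (0 : ℝ) < r := hr
    have hkr : ∀ ω : Metric.sphere (0 : EuclideanSpace ℝ (Fin d)) 1,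
        k (r • (ω : EuclideanSpace ℝ (Fin d))) i j = b r * (if i = j then 1 else 0) +
          (a r - b r) * ((ω : EuclideanSpace ℝ (Fin d)) i * (ω : EuclideanSpace ℝ (Fin d)) j) := by
      intro ω
      have hn : ‖r • (ω : EuclideanSpace ℝ (Fin d))‖ = r := by
        rw [norm_smul, norm_eq_of_mem_sphere, mul_one, Real.norm_of_nonneg hr0.le]
      rw [hk _ (norm_pos_iff.1 (hn.symm ▸ hr0)), hn]
      simp only [PiLp.smul_apply, smul_eq_mul]
      field_simp
    simp only [hkr, smul_eq_mul]
    rw [integral_sphere_entry hd (a r) (b r) hξ i j hr0, Complex.real_smul, ← Complex.ofReal_mul]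
    congr 1
    ring
  rw [setIntegral_congr_fun measurableSet_Ioi key, integral_complex_ofReal]
  refine congrArg Complex.ofReal ?_
  set δ : ℝ := if i = j then 1 else 0
  set q : ℝ := ξ i * ξ j / ‖ξ‖ ^ 2
  -- Both sides are matched as combinations of three integrals: the perpendicular coefficient
  -- multiplies `δ`, and the difference of the two coefficients multiplies `q`.
  calc _ = ∫ r in Ioi (0 : ℝ), ((δ - q) * (r ^ (d - 1) * b r * sphereFourier d (‖ξ‖ * r)) +
          (δ - d * q) * (r ^ (d - 1) * (a r - b r) * sphereFourierPerp d (‖ξ‖ * r)) +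
        q * (r ^ (d - 1) * a r * sphereFourier d (‖ξ‖ * r))) := by
        congr 1; ext r; ring
    _ = _ := by
        rw [integral_linear_combination₃ ib iab ia, Algebra.algebraMap_self_apply]
        ring

/-! ### Fourier inversion almost everywhere -/

section Inversion

variable {V : Type*} [NormedAddCommGroup V] [InnerProductSpace ℝ V] [FiniteDimensional ℝ V]
  [MeasurableSpace V] [BorelSpace V]

lemma continuous_fourier_of_integrable {f : V → ℂ} (hf : Integrable f) : Continuous (𝓕 f) :=
  VectorFourier.fourierIntegral_continuous Real.continuous_fourierChar
    (L := innerₗ V) continuous_inner hf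

lemma integral_fourier_mul_eq_of_integrable {f g : V → ℂ} (hf : Integrable f)
    (hg : Integrable g) : ∫ ξ, 𝓕 f ξ * g ξ = ∫ x, f x * 𝓕 g x := by
  simpa using! VectorFourier.integral_bilin_fourierIntegral_eq_flip (ContinuousLinearMap.mul ℂ ℂ)
    (L := innerₗ V) Real.continuous_fourierChar continuous_inner hf hg

lemma integral_fourierInv_mul_eq_of_integrable {f g : V → ℂ} (hf : Integrable f)
    (hg : Integrable g) : ∫ ξ, 𝓕⁻ f ξ * g ξ = ∫ x, f x * 𝓕⁻ g x := by
  have h := integral_fourier_mul_eq_of_integrable hf.comp_neg hg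
  rw [Real.fourierInv_eq_fourier_comp_neg, h, ← integral_neg_eq_self]
  simp only [neg_neg, Real.fourierInv_eq_fourier_neg]

/-- Without continuity of `f`, equality is tested weakly: both transforms are moved onto a smooth
compactly supported `g`, for which Schwartz inversion applies. -/
lemma fourierInv_fourier_ae_eq {f : V → ℂ} (hf : Integrable f) (hf' : Integrable (𝓕 f)) :
    ∀ᵐ x, 𝓕⁻ (𝓕 f) x = f x := by
  have hcont : Continuous (𝓕⁻ (𝓕 f)) := by
    rw [Real.fourierInv_eq_fourier_comp_neg]
    exact continuous_fourier_of_integrable hf'.comp_neg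
  refine ae_eq_of_integral_contDiff_smul_eq hcont.locallyIntegrable hf.locallyIntegrable ?_
  intro g hg hg'
  have hgC : HasCompactSupport (fun x => (g x : ℂ)) := hg'.comp_left Complex.ofReal_zero
  let φ : SchwartzMap V ℂ := hgC.toSchwartzMap (Complex.ofRealCLM.contDiff.comp hg)
  have hφ : ∀ x, φ x = (g x : ℂ) := fun _ => rfl
  have hinv : ∀ x, 𝓕 (𝓕⁻ φ : SchwartzMap V ℂ) x = (g x : ℂ) := fun x => by
    rw [FourierTransform.fourier_fourierInv_eq, hφ]
  simp only [Complex.real_smul]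
  calc ∫ x, (g x : ℂ) * 𝓕⁻ (𝓕 f) x = ∫ x, 𝓕⁻ (φ : V → ℂ) x * 𝓕 f x :=
        (integral_fourierInv_mul_eq_of_integrable φ.integrable hf').symm
    _ = ∫ x, 𝓕 (𝓕⁻ (φ : V → ℂ)) x * f x := by
        rw [← SchwartzMap.fourierInv_coe]
        exact (integral_fourier_mul_eq_of_integrable (𝓕⁻ φ).integrable hf).symm
    _ = ∫ x, (g x : ℂ) * f x := by
        rw [← SchwartzMap.fourierInv_coe, ← SchwartzMap.fourier_coe]
        simp only [hinv]

end Inversion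

/-! ### Passing between `ℝᵈ` and the half-line -/

/-- The indicator of the failure of `P`, composed with the norm, vanishes almost everywhere. Hence
its radial integral against `r ^ (d - 1)` is zero, with a nonnegative integrand and a weight that is
positive on the half-line. No measurability of `P` is required. -/
lemma ae_Ioi_of_ae_norm [NeZero d] {P : ℝ → Prop}
    (h : ∀ᵐ x : EuclideanSpace ℝ (Fin d), P ‖x‖) :
    ∀ᵐ r ∂(volume.restrict (Ioi (0 : ℝ))), P r := by
  classical
  let f : ℝ → ℝ := fun r => if P r then 0 else 1
  have hf : (fun x : EuclideanSpace ℝ (Fin d) => f ‖x‖) =ᵐ[volume] 0 := by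
    filter_upwards [h] with x hx
    simp [f, hx]
  have hint : Integrable (fun x : EuclideanSpace ℝ (Fin d) => f ‖x‖) :=
    (integrable_zero _ _ _).congr hf.symm
  have hzero := integral_fun_norm_addHaar (volume : Measure (EuclideanSpace ℝ (Fin d))) f
  rw [integral_congr_ae hf] at hzero
  rw [integrable_fun_norm_addHaar, finrank_euclideanSpace_fin] at hint
  have hball : (volume : Measure (EuclideanSpace ℝ (Fin d))).real (Metric.ball 0 1) ≠ 0 :=
    ENNReal.toReal_ne_zero.2
      ⟨(Metric.measure_ball_pos _ _ one_pos).ne', measure_ball_lt_top.ne⟩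
  simp only [Pi.zero_apply, integral_zero, finrank_euclideanSpace_fin, nsmul_eq_mul,
    Nat.cast_eq_zero, NeZero.ne d, false_or, smul_eq_zero, hball,
    eq_comm (a := (0 : ℝ)), mul_eq_zero] at hzero
  rw [integral_eq_zero_iff_of_nonneg_ae _ hint] at hzero
  · filter_upwards [hzero, ae_restrict_mem measurableSet_Ioi] with r hr hr0
    have h0 : (0 : ℝ) < r := hr0
    by_contra hP
    simp [f, hP, h0.ne'] at hr
  · filter_upwards [ae_restrict_mem measurableSet_Ioi] with r hr0
    have h0 : (0 : ℝ) < r := hr0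
    have : 0 ≤ f r := by
      simp only [f]
      split_ifs <;> norm_num
    exact mul_nonneg (by positivity) this

/-- If the values differed at `r`, they would differ on a neighbourhood, which has positive measure.
-/
lemma eq_of_ae_eq_of_continuousAt {f g : ℝ → ℝ}
    (h : ∀ᵐ r ∂(volume.restrict (Ioi (0 : ℝ))), f r = g r) {r : ℝ} (hr : 0 < r)
    (hf : ContinuousAt f r) (hg : ContinuousAt g r) : f r = g r := by
  by_contra hne
  have hU : {y | f y ≠ g y} ∈ nhds r := 
    ((hf.sub hg).eventually_ne (sub_ne_zero.2 hne)).mono fun _ => sub_ne_zero.1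
  rw [ae_restrict_iff' measurableSet_Ioi] at h
  have hpos := Measure.measure_pos_of_mem_nhds volume (Filter.inter_mem hU (Ioi_mem_nhds hr))
  have hz := measure_mono_null (fun y (hy : y ∈ {y | f y ≠ g y} ∩ Ioi 0) =>
    (show ¬ (y ∈ Ioi (0 : ℝ) → f y = g y) from fun hc => hy.1 (hc hy.2))) h
  exact hpos.ne' hz

/-- On a coordinate axis the matrix is diagonal, so single entries display the coefficients; this
gives both their uniqueness and their continuity. -/
lemma HasCoefficients.apply_single {𝕜 : Type*} [RCLike 𝕜]
    {F : EuclideanSpace ℝ (Fin d) → Matrix (Fin d) (Fin d) 𝕜} {a b : ℝ → ℝ}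
    (hF : HasCoefficients F a b) {r : ℝ} (hr : 0 < r) (i : Fin d) :
    F (r • EuclideanSpace.single i 1) i i = a r ∧
      ∀ j, j ≠ i → F (r • EuclideanSpace.single i 1) j j = b r := by
  have hn : ‖r • (EuclideanSpace.single i 1 : EuclideanSpace ℝ (Fin d))‖ = r := by
    rw [norm_smul, PiLp.norm_single, norm_one, mul_one, Real.norm_of_nonneg hr.le]
  have h := hasCoefficients_iff.1 hF _ (norm_pos_iff.1 (hn.symm ▸ hr))
  refine ⟨?_, fun j hj => ?_⟩
  · rw [h, hn]
    congr 1
    simp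
    field_simp
    ring
  · rw [h, hn]
    congr 1
    simp [hj]

/-- The radial matrix field with given coefficients. -/
def radialField (d : ℕ) (a b : ℝ → ℝ) (x : EuclideanSpace ℝ (Fin d)) :
    Matrix (Fin d) (Fin d) ℝ :=
  a ‖x‖ • prPar x + b ‖x‖ • prPerp x

lemma hasCoefficients_radialField (a b : ℝ → ℝ) : HasCoefficients (radialField d a b) a b := by
  intro x _
  rw [radialField, Algebra.algebraMap_self]
  exact (Matrix.map_id _).symm

lemma HasCoefficients.ofReal_radialField {F : EuclideanSpace ℝ (Fin d) → Matrix (Fin d) (Fin d) ℂ}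
    {a b : ℝ → ℝ} (hF : HasCoefficients F a b) {x : EuclideanSpace ℝ (Fin d)} (hx : x ≠ 0)
    (i j : Fin d) : (radialField d a b x i j : ℂ) = F x i j := by
  rw [hF x hx]
  rfl

lemma HasCoefficients.matIntegrable_radialField [NeZero d]
    {F : EuclideanSpace ℝ (Fin d) → Matrix (Fin d) (Fin d) ℂ}
    {a b : ℝ → ℝ} (hF : HasCoefficients F a b) (hi : MatIntegrable F) :
    MatIntegrable (radialField d a b) := by
  intro i j
  refine (hi i j).re.congr ?_
  filter_upwards [ae_ne_zero] with x hx
  rw [← hF.ofReal_radialField hx]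
  simp

lemma continuousOn_coeffMap (hd : 2 ≤ d)
    {k : EuclideanSpace ℝ (Fin d) → Matrix (Fin d) (Fin d) ℝ} {a b : ℝ → ℝ}
    (hk : HasCoefficients k a b) (hi : MatIntegrable k) :
    ContinuousOn (coeffMap d (a, b)).1 (Ioi 0) ∧ ContinuousOn (coeffMap d (a, b)).2 (Ioi 0) := by
  have : NeZero d := ⟨by omega⟩
  have : Nontrivial (Fin d) := Fin.nontrivial_iff_two_le.2 hd
  obtain ⟨i, hne⟩ := exists_ne (0 : Fin d)
  have hcont : ∀ i, Continuous fun r : ℝ =>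
      (matFourier k (r • EuclideanSpace.single 0 1) i i).re := fun i =>
    Complex.continuous_re.comp ((continuous_fourier_of_integrable (hi i i).ofReal).comp
      (by fun_prop))
  have hval := fun {r : ℝ} (hr : r ∈ Ioi (0 : ℝ)) =>
    (hasCoefficients_matFourier hd hk hi).apply_single hr 0
  refine ⟨(hcont 0).continuousOn.congr fun r hr => ?_, (hcont i).continuousOn.congr fun r hr => ?_⟩
  · simp only [(hval hr).1]
    rfl
  · simp only [(hval hr).2 i hne]
    rfl

/-- Off the origin the transform of `k` equals the real field `radialField d α β`, so the forward
theorem applies to that field, and inversion identifies its transform at `-x` with `k x`. -/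
lemma ae_eq_coeffMap (hd : 2 ≤ d)
    {k : EuclideanSpace ℝ (Fin d) → Matrix (Fin d) (Fin d) ℝ} {a b : ℝ → ℝ}
    (hk : HasCoefficients k a b) (hi : MatIntegrable k) (hhat : MatIntegrable (matFourier k))
    {α β : ℝ → ℝ} (hαβ : HasCoefficients (matFourier k) α β) :
    ∀ᵐ r ∂(volume.restrict (Ioi (0 : ℝ))),
      a r = (coeffMap d (α, β)).1 r ∧ b r = (coeffMap d (α, β)).2 r := by
  have : NeZero d := ⟨by omega⟩
  have hrad := hasCoefficients_iff.1 (hasCoefficients_matFourier hd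
    (hasCoefficients_radialField α β) (hαβ.matIntegrable_radialField hhat))
  have hk' := hasCoefficients_iff.1 hk
  have hinv : ∀ i j, ∀ᵐ x, matFourier (radialField d α β) (-x) i j = (k x i j : ℂ) := by
    intro i j
    have hcongr : 𝓕 (fun x => (k x i j : ℂ)) =ᵐ[volume]
        fun x => (radialField d α β x i j : ℂ) := by
      filter_upwards [ae_ne_zero] with x hx
      exact (hαβ.ofReal_radialField hx i j).symm
    have hiC : Integrable (fun x => (k x i j : ℂ)) := (hi i j).ofReal
    filter_upwards [fourierInv_fourier_ae_eq hiC (hhat i j)] with x hx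
    rw [Real.fourierInv_eq_fourier_neg, Real.fourier_congr_ae hcongr] at hx
    exact hx
  refine ae_Ioi_of_ae_norm (d := d) ?_
  filter_upwards [ae_all_iff.2 fun i => ae_all_iff.2 (hinv i), ae_ne_zero] with x hx hx0
  refine eq_of_entry_eq hd hx0 fun i j => ?_
  have h := hx i j
  -- A radial field is even, since `x i * x j` and `‖x‖` are unchanged by `x ↦ -x`; this removes the
  -- sign.
  rw [hrad _ (neg_ne_zero.2 hx0), hk' x hx0] at h
  simp only [norm_neg, PiLp.neg_apply, neg_mul_neg] at h
  exact (Complex.ofReal_injective h).symm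

end TRI

end

theorem proposition3p14 (d : ℕ) (hd : 2 ≤ d)
    (k : EuclideanSpace ℝ (Fin d) → Matrix (Fin d) (Fin d) ℝ) (kpar kperp : ℝ → ℝ)
    (hk : TRI.HasCoefficients k kpar kperp)
    (hk_int : TRI.MatIntegrable k)
    (hhat_int : TRI.MatIntegrable (TRI.matFourier k)) :
    (∃ hpar hperp : ℝ → ℝ, TRI.HasCoefficients (TRI.matFourier k) hpar hperp) ∧
    (∀ hpar hperp : ℝ → ℝ, TRI.HasCoefficients (TRI.matFourier k) hpar hperp →
      (∀ ρ : ℝ, 0 < ρ → TRI.CoeffMapConverges d (kpar, kperp) ρ ∧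
        hpar ρ = (TRI.coeffMap d (kpar, kperp)).1 ρ ∧
        hperp ρ = (TRI.coeffMap d (kpar, kperp)).2 ρ) ∧
      (∀ r : ℝ, 0 < r → TRI.CoeffMapConverges d (hpar, hperp) r) ∧
      (∀ᵐ r ∂(volume.restrict (Ioi (0 : ℝ))),
        kpar r = (TRI.coeffMap d (hpar, hperp)).1 r ∧
        kperp r = (TRI.coeffMap d (hpar, hperp)).2 r) ∧
      (∀ r : ℝ, 0 < r → ContinuousAt kpar r →
        kpar r = (TRI.coeffMap d (hpar, hperp)).1 r) ∧
      (∀ r : ℝ, 0 < r → ContinuousAt kperp r →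
        kperp r = (TRI.coeffMap d (hpar, hperp)).2 r)) ∧
    (∀ᵐ r ∂(volume.restrict (Ioi (0 : ℝ))),
      (TRI.coeffMap d (TRI.coeffMap d (kpar, kperp))).1 r = kpar r ∧
      (TRI.coeffMap d (TRI.coeffMap d (kpar, kperp))).2 r = kperp r) := by
  have : NeZero d := ⟨by omega⟩
  have : Nontrivial (Fin d) := Fin.nontrivial_iff_two_le.2 hd
  obtain ⟨i, hne⟩ := exists_ne (0 : Fin d)
  have hM := TRI.hasCoefficients_matFourier hd hk hk_int
  refine ⟨⟨_, _, hM⟩, fun hpar hperp hh => ?_, ?_⟩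
  · have hrad := TRI.hasCoefficients_radialField (d := d) hpar hperp
    have hrad_int := hh.matIntegrable_radialField hhat_int
    obtain ⟨ka, kb⟩ := TRI.integrableOn_coefficients hd hk hk_int
    obtain ⟨ha, hb⟩ := TRI.integrableOn_coefficients hd hrad hrad_int
    obtain ⟨hc1, hc2⟩ := TRI.continuousOn_coeffMap hd hrad hrad_int
    have hae := TRI.ae_eq_coeffMap hd hk hk_int hhat_int hh
    refine ⟨fun ρ hρ => ⟨TRI.coeffMapConverges_of_integrableOn hd ka kb hρ, ?_, ?_⟩,
      fun r hr => TRI.coeffMapConverges_of_integrableOn hd ha hb hr, hae,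
      fun r hr hc => TRI.eq_of_ae_eq_of_continuousAt (hae.mono fun _ h => h.1) hr hc
        (hc1.continuousAt (Ioi_mem_nhds hr)),
      fun r hr hc => TRI.eq_of_ae_eq_of_continuousAt (hae.mono fun _ h => h.2) hr hc
        (hc2.continuousAt (Ioi_mem_nhds hr))⟩
    · exact Complex.ofReal_injective
        ((hh.apply_single hρ 0).1.symm.trans (hM.apply_single hρ 0).1)
    · exact Complex.ofReal_injective
        (((hh.apply_single hρ 0).2 i hne).symm.trans ((hM.apply_single hρ 0).2 i hne))
  -- The involution is the converse formula applied to the particular coefficients `M(k)` of the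
  -- transform.
  · filter_upwards [TRI.ae_eq_coeffMap hd hk hk_int hhat_int hM] with r hr
    exact ⟨hr.1.symm, hr.2.symm⟩
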